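/- Let $\mathcal G=(V,\mathcal B,E)$ be a Borel graph, that is, $(V,\mathcal B)$ is a standard Borel space and $(V,E)$ is a simple graph whose edge relation $E\subseteq V\times V$ is a Borel symmetric set. Suppose that $\mathcal G$ is acyclic, that there is a finite uniform bound on the degrees of its vertices, and that every vertex has even degree. Identify edges with unordered pairs, so that the edge set (again written $E$) is a standard Borel space with the $\sigma$-algebra inherited from the unordered pairs of elements of $V$; let $[E]^{<\infty}$ be the standard Borel space of finite subsets of $E$, and let $\mathfrak T\subseteq [E]^{<\infty}$ be the set of all finite paths of $\mathcal G$ with at least one edge, each regarded as the set of its edges. For $\mathfrak P\subseteq\mathfrak T$ let $\operatorname{E}(\mathfrak P)\subseteq V$ be the set of all endpoints of paths $T\in\mathfrak P$. Then there is a sequence $\{\mathfrak P_n\}_{n\in\mathbb N}$ of Borel subsets of $\mathfrak T$ such that 1. $E\subseteq\bigcup\mathfrak P_0$, that is, every edge belongs to some path in $\mathfrak P_0$; 2. $T\cap T'=\emptyset$ (the paths have no common edge) for every $n\in\mathbb N$ and all $T\neq T'$ in $\mathfrak P_n$; 3. for every $n\in\mathbb N$ and every $T\in\mathfrak P_n$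 there is a unique $T'\in\mathfrak P_{n+1}$ such that $T\subseteq T'$; 4. $\bigcap_{n\in\mathbb N}\operatorname{E}(\mathfrak P_n)=\emptyset$. -/

import Mathlib

namespace BorelGraph

/-- The quotient `σ`-algebra on unordered pairs: a set of unordered pairs is Borel iff the
corresponding symmetric set of ordered pairs is Borel in `X × X`. -/
@[reducible] def sym2Borel (X : Type*) [MeasurableSpace X] : MeasurableSpace (Sym2 X) :=
  MeasurableSpace.map (fun p : X × X => s(p.1, p.2)) inferInstance

open Classical in
/-- The `σ`-algebra on the space `[X]^{<∞}` of finite subsets of `X`: a family of finite sets is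
Borel iff for every `n` the set of tuples `(x₁, …, xₙ)` for which `{x₁, …, xₙ}` belongs
to the family is measurable in `Xⁿ`. (The infimum is the intersection of `σ`-algebras. Mathlib's
instance on `Finset X`, generated by the sets `{F | x ∈ F}` for single points `x`, ignores the
`σ`-algebra of `X` and is not the Borel structure meant here.) -/
@[reducible] noncomputable def finsetBorel {X : Type*} (m : MeasurableSpace X) : MeasurableSpace (Finset X) :=
  ⨅ n : ℕ, MeasurableSpace.map (fun x : Fin n → X => Finset.image x Finset.univ)
    (@MeasurableSpace.pi (Fin n) (fun _ => X) (fun _ => m))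

/-- A collection of finite sets of unordered pairs of elements of `V` is Borel. -/
def IsBorelFamily {V : Type*} [MeasurableSpace V] (P : Set (Finset (Sym2 V))) : Prop :=
  @MeasurableSet (Finset (Sym2 V)) (finsetBorel (sym2Borel V)) P

/-- `G` is a Borel graph: its adjacency relation is a Borel subset of `V × V`. (To be used on a
standard Borel space `V`.) -/
def IsBorel {V : Type*} [MeasurableSpace V] (G : SimpleGraph V) : Prop :=
  MeasurableSet {p : V × V | G.Adj p.1 p.2}

/-- There is a finite uniform bound on the degrees of the vertices of `G`. -/
def IsBoundedDegree {V : Type*} (G : SimpleGraph V) : Prop :=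
  ∃ d : ℕ, ∀ v : V, (G.neighborSet v).encard ≤ d

/-- `T` is the edge set of a finite path of `G`, with at least one edge and without repeated
vertices, that starts at `u` and ends at `v`. -/
def IsPathBetween {V : Type*} (G : SimpleGraph V) (T : Finset (Sym2 V)) (u v : V) : Prop :=
  ∃ p : G.Walk u v, p.IsPath ∧ 0 < p.length ∧ ∀ e : Sym2 V, e ∈ T ↔ e ∈ p.edges

/-- The set of all finite paths of `G`, a path being regarded as the finite set of its edges. -/
def finitePaths {V : Type*} (G : SimpleGraph V) : Set (Finset (Sym2 V)) :=
  {T | ∃ u v : V, IsPathBetween G T u v}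

/-- The set of all endpoints of the paths that belong to the collection `P`. -/
def endpoints {V : Type*} (G : SimpleGraph V) (P : Set (Finset (Sym2 V))) : Set V :=
  {u | ∃ T ∈ P, ∃ v : V, IsPathBetween G T u v}

end BorelGraph

/-!
Pair the edges at every vertex of `G` in a Borel way, which is possible as the degrees are even.
Following the pairing through the vertices decomposes the edges of the acyclic graph `G` into
bi-infinite lines. It then suffices to cut the lines into finite segments, at corners taken from a
decreasing sequence `C n` of Borel sets such that every `C n` meets each line infinitely often in
both directions while `⋂ n, C n = ∅`: the segments for `C (n + 1)` are unions of segments for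
`C n`, and since every vertex lies on finitely many corners, none is an endpoint at every stage.

* The pairing (`exists_measurable_edgePairing`) reverses the order of the neighbours of each
  vertex with respect to a Borel linear order on `V`. The increasing list of all neighbours of a
  vertex is unique, so the Lusin–Souslin theorem on injective images makes the pairing Borel; no
  general uniformization theorem is needed.
* The corners (`exists_vanishing_corners`) come from a bounded injective Borel function `f` on
  directed edges. Its limit inferior along the forward half of a line does not depend on the
  starting point, the values of `f` approach it infinitely often, and they equal it at most once;
  so one takes the directed edges where `f` is close but not equal to this limit. Adding their
  images under the pairing makes the set independent of the direction of travel.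
* A segment is determined by its first directed edge and its length. A tuple of edges enumerating a
  segment contains that first edge, so the family of segments is Borel without any quantifier over
  an uncountable set (`isBorelFamily_segments`).
-/

namespace BorelGraph

open Set Filter

/-! ### Borel enumeration of neighbours -/

section Neighbors

variable {V : Type*} {G : SimpleGraph V}

/-- The pairs `(w, t)` in which `t` lists `k` neighbours of `w` in increasing order. -/
def neighborLists [LinearOrder V] (G : SimpleGraph V) (k : ℕ) : Set (V × (Fin k → V)) :=
  {q | StrictMono q.2 ∧ ∀ i, G.Adj q.1 (q.2 i)}

theorem eq_orderEmbOfFin_of_mem_neighborLists [LinearOrder V]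
    (hfin : ∀ w, (G.neighborSet w).Finite) {k : ℕ} {q : V × (Fin k → V)}
    (hq : q ∈ neighborLists G k) (hk : (hfin q.1).toFinset.card = k) :
    q.2 = (hfin q.1).toFinset.orderEmbOfFin hk :=
  Finset.orderEmbOfFin_unique hk (fun i => by simpa using hq.2 i) hq.1

theorem card_le_of_mem_neighborLists [LinearOrder V]
    (hfin : ∀ w, (G.neighborSet w).Finite) {k : ℕ} {q : V × (Fin k → V)}
    (hq : q ∈ neighborLists G k) : k ≤ (hfin q.1).toFinset.card := by
  have h := Finset.card_le_card_of_injOn (s := Finset.univ) (t := (hfin q.1).toFinset) q.2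
    (fun i _ => by simpa using hq.2 i) hq.1.injective.injOn
  simpa using h

theorem orderEmbOfFin_mem_neighborLists [LinearOrder V]
    (hfin : ∀ w, (G.neighborSet w).Finite) {k : ℕ} {w : V}
    (hk : (hfin w).toFinset.card = k) :
    (w, ⇑((hfin w).toFinset.orderEmbOfFin hk)) ∈ neighborLists G k :=
  ⟨((hfin w).toFinset.orderEmbOfFin hk).strictMono, fun i =>
    (hfin w).mem_toFinset.1 (Finset.orderEmbOfFin_mem (hfin w).toFinset hk i)⟩

variable [MeasurableSpace V]

theorem measurableSet_neighborLists [LinearOrder V]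
    (hlt : MeasurableSet {p : V × V | p.1 < p.2}) (hG : IsBorel G) (k : ℕ) :
    MeasurableSet (neighborLists G k) := by
  have h : neighborLists G k =
      (⋂ i : Fin k, ⋂ j : Fin k, ⋂ _ : i < j,
        (fun q : V × (Fin k → V) => (q.2 i, q.2 j)) ⁻¹' {p : V × V | p.1 < p.2}) ∩
      ⋂ i : Fin k, (fun q : V × (Fin k → V) => (q.1, q.2 i)) ⁻¹' {p : V × V | G.Adj p.1 p.2} := by
    ext q
    simp [neighborLists, StrictMono]
  rw [h]
  refine MeasurableSet.inter
    (.iInter fun i => .iInter fun j => .iInter fun _ => ?_) (.iInter fun i => ?_)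
  · exact (by fun_prop : Measurable fun q : V × (Fin k → V) => (q.2 i, q.2 j)) hlt
  · exact (by fun_prop : Measurable fun q : V × (Fin k → V) => (q.1, q.2 i)) hG

/-- On the vertices of degree at most `k` the increasing list of `k` neighbours is unique when it
exists, so the vertices of degree `k` form an injective image of a Borel set; the Lusin–Souslin
theorem then gives the claim by downward induction from the degree bound. -/
theorem measurableSet_degree_le [StandardBorelSpace V] [LinearOrder V]
    (hlt : MeasurableSet {p : V × V | p.1 < p.2}) (hG : IsBorel G)
    (hfin : ∀ w, (G.neighborSet w).Finite) {d : ℕ}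
    (hd : ∀ w, (hfin w).toFinset.card ≤ d) (k : ℕ) :
    MeasurableSet {w | (hfin w).toFinset.card ≤ k} := by
  have hall : ∀ j k, d ≤ k + j → MeasurableSet {w | (hfin w).toFinset.card ≤ k} := by
    intro j
    induction j with
    | zero =>
      intro k hk
      convert MeasurableSet.univ
      exact eq_univ_of_forall fun w => (hd w).trans hk
    | succ j ih =>
      intro k hk
      have ih' := ih (k + 1) (by omega)
      have himg : {w | (hfin w).toFinset.card ≤ k} = {w | (hfin w).toFinset.card ≤ k + 1} \
          (Prod.fst '' (neighborLists G (k + 1) ∩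
            Prod.fst ⁻¹' {w | (hfin w).toFinset.card ≤ k + 1})) := by
        ext w
        constructor
        · rintro hw
          refine ⟨Nat.le_succ_of_le hw, ?_⟩
          rintro ⟨q, ⟨hq, -⟩, rfl⟩
          have := card_le_of_mem_neighborLists hfin hq
          simp only [mem_ofPred_eq] at hw
          omega
        · rintro ⟨hw, hw'⟩
          by_contra hlt'
          simp only [mem_ofPred_eq] at hw hlt'
          exact hw' ⟨_, ⟨orderEmbOfFin_mem_neighborLists hfin (k := k + 1) (w := w) (by omega), hw⟩,
            rfl⟩
      rw [himg]
      refine ih'.diff (MeasurableSet.image_of_measurable_injOn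
        ((measurableSet_neighborLists hlt hG _).inter (measurable_fst ih')) measurable_fst ?_)
      rintro ⟨w, t⟩ ⟨hq, hw⟩ ⟨w', t'⟩ ⟨hq', -⟩ (rfl : w = w')
      have hk' : (hfin w).toFinset.card = k + 1 :=
        le_antisymm hw (card_le_of_mem_neighborLists hfin hq)
      exact Prod.ext rfl ((eq_orderEmbOfFin_of_mem_neighborLists hfin hq hk').trans
        (eq_orderEmbOfFin_of_mem_neighborLists hfin hq' hk').symm)
  exact hall d k (Nat.le_add_left d k)

theorem measurableSet_degree_eq [StandardBorelSpace V] [LinearOrder V]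
    (hlt : MeasurableSet {p : V × V | p.1 < p.2}) (hG : IsBorel G)
    (hfin : ∀ w, (G.neighborSet w).Finite) {d : ℕ}
    (hd : ∀ w, (hfin w).toFinset.card ≤ d) (k : ℕ) :
    MeasurableSet {w | (hfin w).toFinset.card = k} := by
  have h := measurableSet_degree_le hlt hG hfin hd
  cases k with
  | zero => simpa only [Nat.le_zero] using h 0
  | succ k =>
    convert (h (k + 1)).diff (h k) using 1
    ext w
    simp only [mem_ofPred_eq, Set.mem_sdiff]
    omega

end Neighbors

/-! ### Pairing the edges at each vertex -/

/-- A pairing of the edges at each vertex of `G`, presented as an involution on the pairs of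
vertices: for an edge directed from `v` to `w`, the pair `(v, w)` is sent to `(v', w)`, where
`{v', w}` is the edge paired with `{v, w}` at `w`. The involution is total on `V × V`, but only
its values on adjacent pairs matter. -/
structure EdgePairing {V : Type*} (G : SimpleGraph V) where
  /-- The involution on pairs of vertices. -/
  toFun : V × V → V × V
  involutive : Function.Involutive toFun
  snd_apply : ∀ x, (toFun x).2 = x.2
  adj_apply : ∀ x, G.Adj x.1 x.2 → G.Adj (toFun x).1 (toFun x).2
  apply_ne : ∀ x, G.Adj x.1 x.2 → toFun x ≠ x

section

variable {V : Type*} {G : SimpleGraph V}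

open Classical in
/-- The order-reversing map of the neighbours of `x.2`, applied to `x.1`; a vertex `x.1` that is
not a neighbour of `x.2` is left alone. -/
noncomputable def reverseNeighbor [LinearOrder V] (hfin : ∀ w, (G.neighborSet w).Finite)
    (x : V × V) : V :=
  if h : x.1 ∈ (hfin x.2).toFinset then
    (hfin x.2).toFinset.orderEmbOfFin rfl
      (Fin.rev (((hfin x.2).toFinset.orderIsoOfFin rfl).symm ⟨x.1, h⟩))
  else x.1

theorem reverseNeighbor_of_not_adj [LinearOrder V] (hfin : ∀ w, (G.neighborSet w).Finite)
    {v w : V} (h : ¬ G.Adj w v) : reverseNeighbor hfin (v, w) = v := by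
  simp [reverseNeighbor, h]

theorem reverseNeighbor_orderEmbOfFin [LinearOrder V] (hfin : ∀ w, (G.neighborSet w).Finite)
    {w : V} {k : ℕ} (hk : (hfin w).toFinset.card = k) (i : Fin k) :
    reverseNeighbor hfin ((hfin w).toFinset.orderEmbOfFin hk i, w) =
      (hfin w).toFinset.orderEmbOfFin hk i.rev := by
  subst hk
  have h : (hfin w).toFinset.orderEmbOfFin rfl i ∈ (hfin w).toFinset :=
    Finset.orderEmbOfFin_mem _ _ _
  rw [reverseNeighbor, dif_pos h]
  congr 2
  rw [OrderIso.symm_apply_eq]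
  rfl

theorem exists_orderEmbOfFin_eq [LinearOrder V] (hfin : ∀ w, (G.neighborSet w).Finite)
    {v w : V} (h : G.Adj w v) {k : ℕ} (hk : (hfin w).toFinset.card = k) :
    ∃ i, (hfin w).toFinset.orderEmbOfFin hk i = v := by
  have : v ∈ Set.range ((hfin w).toFinset.orderEmbOfFin hk) := by
    rw [Finset.range_orderEmbOfFin]
    simpa using h
  exact this

/-- Reversing the order of the neighbours of each vertex pairs its edges: a list of even length has
no middle element. -/
noncomputable def reversePairing [LinearOrder V] (hfin : ∀ w, (G.neighborSet w).Finite)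
    (heven : ∀ w, Even (hfin w).toFinset.card) : EdgePairing G where
  toFun x := (reverseNeighbor hfin x, x.2)
  involutive := by
    rintro ⟨v, w⟩
    by_cases h : G.Adj w v
    · obtain ⟨i, rfl⟩ := exists_orderEmbOfFin_eq hfin h rfl
      simp [reverseNeighbor_orderEmbOfFin]
    · simp [reverseNeighbor_of_not_adj hfin h]
  snd_apply _ := rfl
  adj_apply := by
    rintro ⟨v, w⟩ h
    obtain ⟨i, rfl⟩ := exists_orderEmbOfFin_eq hfin (show G.Adj w v from h.symm) rfl
    simp only [reverseNeighbor_orderEmbOfFin]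
    exact ((orderEmbOfFin_mem_neighborLists hfin rfl).2 _).symm
  apply_ne := by
    rintro ⟨v, w⟩ h heq
    obtain ⟨i, rfl⟩ := exists_orderEmbOfFin_eq hfin (show G.Adj w v from h.symm) rfl
    have h1 := congrArg Prod.fst heq
    simp only [reverseNeighbor_orderEmbOfFin] at h1
    have h2 := congrArg Fin.val (((hfin w).toFinset.orderEmbOfFin rfl).injective h1)
    obtain ⟨m, hm⟩ := heven w
    have := i.isLt
    rw [Fin.val_rev] at h2
    omega

/-- On adjacent pairs, the preimage of a Borel set under `reverseNeighbor` is a countable union of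
injective images of Borel sets of increasing lists of neighbours. -/
theorem measurable_reverseNeighbor [MeasurableSpace V] [StandardBorelSpace V] [LinearOrder V]
    (hlt : MeasurableSet {p : V × V | p.1 < p.2}) (hG : IsBorel G)
    (hfin : ∀ w, (G.neighborSet w).Finite) {d : ℕ}
    (hd : ∀ w, (hfin w).toFinset.card ≤ d) :
    Measurable (reverseNeighbor hfin) := by
  intro A hA
  have hset : reverseNeighbor hfin ⁻¹' A =
      ({x : V × V | G.Adj x.1 x.2}ᶜ ∩ Prod.fst ⁻¹' A) ∪
      ⋃ k : ℕ, ⋃ i : Fin k, (fun q : V × (Fin k → V) => (q.2 i, q.1)) ''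
        (neighborLists G k ∩ (Prod.fst ⁻¹' {w | (hfin w).toFinset.card = k} ∩
          (fun q => q.2 i.rev) ⁻¹' A)) := by
    ext ⟨v, w⟩
    by_cases h : G.Adj w v
    · simp only [mem_preimage, mem_union, mem_inter_iff, mem_compl_iff, mem_ofPred_eq, h.symm,
        not_true, false_and, false_or, mem_iUnion, mem_image, Prod.mk.injEq]
      constructor
      · intro hA
        obtain ⟨i, rfl⟩ := exists_orderEmbOfFin_eq hfin h rfl
        rw [reverseNeighbor_orderEmbOfFin] at hA
        exact ⟨_, i, _, ⟨orderEmbOfFin_mem_neighborLists hfin rfl, rfl, hA⟩, rfl, rfl⟩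
      · rintro ⟨k, i, ⟨w, t⟩, ⟨hq, hk, hA⟩, rfl, rfl⟩
        have ht := eq_orderEmbOfFin_of_mem_neighborLists hfin hq hk
        simp only at ht hA ⊢
        rw [ht] at hA ⊢
        rwa [reverseNeighbor_orderEmbOfFin]
    · simp only [mem_preimage, reverseNeighbor_of_not_adj hfin h, mem_union, mem_inter_iff,
        mem_compl_iff, mem_ofPred_eq, G.adj_comm v w, h, not_false_eq_true, true_and]
      refine ⟨Or.inl, ?_⟩
      rintro (h' | h')
      · exact h'
      · simp only [mem_iUnion, mem_image, Prod.mk.injEq] at h'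
        obtain ⟨k, i, ⟨w', t⟩, ⟨hq, -⟩, rfl, rfl⟩ := h'
        exact absurd (hq.2 i) h
  rw [hset]
  refine (MeasurableSet.inter (MeasurableSet.compl hG) (measurable_fst hA)).union
    (.iUnion fun k => .iUnion fun i => ?_)
  refine MeasurableSet.image_of_measurable_injOn
    ((measurableSet_neighborLists hlt hG k).inter
      ((measurable_fst (measurableSet_degree_eq hlt hG hfin hd k)).inter
        ((by fun_prop : Measurable fun q : V × (Fin k → V) => q.2 i.rev) hA))) (by fun_prop) ?_
  rintro ⟨w, t⟩ ⟨hq, hk, -⟩ ⟨w', t'⟩ ⟨hq', -⟩ h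
  obtain rfl : w = w' := congrArg Prod.snd h
  exact Prod.ext rfl ((eq_orderEmbOfFin_of_mem_neighborLists hfin hq hk).trans
    (eq_orderEmbOfFin_of_mem_neighborLists hfin hq' hk).symm)

theorem exists_measurable_edgePairing [MeasurableSpace V] [StandardBorelSpace V] [LinearOrder V]
    (hlt : MeasurableSet {p : V × V | p.1 < p.2}) (hG : IsBorel G) (hbdd : IsBoundedDegree G)
    (heven : ∀ v, Even (G.neighborSet v).ncard) :
    ∃ τ : EdgePairing G, Measurable τ.toFun := by
  obtain ⟨d, hd⟩ := hbdd
  have hfin : ∀ w, (G.neighborSet w).Finite := fun w => Set.finite_of_encard_le_coe (hd w)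
  have hcard : ∀ w, (hfin w).toFinset.card = (G.neighborSet w).ncard := fun w =>
    (Set.ncard_eq_toFinset_card _ (hfin w)).symm
  refine ⟨reversePairing hfin fun w => hcard w ▸ heven w, ?_⟩
  refine (measurable_reverseNeighbor hlt hG hfin (d := d) fun w => ?_).prodMk measurable_snd
  have := hd w
  rw [← (hfin w).cast_ncard_eq, ← hcard] at this
  exact_mod_cast this

end

/-! ### The lines of a pairing -/

namespace EdgePairing

variable {V : Type*} {G : SimpleGraph V} (τ : EdgePairing G)

/-- The shift along the lines of the pairing: an edge directed from `v` to `w` is sent to the edge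
paired with it at `w`, directed away from `w`. -/
def step : Equiv.Perm (V × V) :=
  τ.involutive.toPerm.trans (Equiv.prodComm V V)

/-- The directed edge `n` steps after `x` on its line; `n` may be negative. -/
def dart (x : V × V) (n : ℤ) : V × V := (τ.step ^ n) x

theorem step_apply (x : V × V) : τ.step x = (x.2, (τ.toFun x).1) := by
  simp [step, Prod.swap, τ.snd_apply]

@[simp] theorem dart_zero (x : V × V) : τ.dart x 0 = x := rfl

@[simp] theorem dart_dart (x : V × V) (m n : ℤ) : τ.dart (τ.dart x m) n = τ.dart x (m + n) := by
  rw [dart, dart, dart, add_comm, zpow_add]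
  rfl

theorem dart_one (x : V × V) : τ.dart x 1 = τ.step x := by
  rw [dart, zpow_one]

theorem dart_neg_one (x : V × V) : τ.dart x (-1) = τ.toFun x.swap := by
  rw [dart, zpow_neg_one, Equiv.Perm.inv_eq_iff_eq, step, Equiv.trans_apply,
    Function.Involutive.coe_toPerm, τ.involutive, Equiv.prodComm_apply, Prod.swap_swap]

/-- Exchanging the two ends of directed edges reverses the direction of travel on each line. -/
theorem dart_swap (x : V × V) (n : ℤ) : τ.dart x.swap n = (τ.dart x (-n)).swap := by
  have hone : ∀ y : V × V, τ.dart y.swap 1 = (τ.dart y (-1)).swap := by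
    intro y
    rw [dart_one, step_apply, dart_neg_one]
    exact Prod.ext (τ.snd_apply _).symm rfl
  induction n with
  | zero => rfl
  | succ n ih =>
    rw [← dart_dart, ih, hone, dart_dart, neg_add]
  | pred n ih =>
    have h := hone (τ.dart x (n + 1))
    rw [dart_dart, add_neg_cancel_right] at h
    have h' : τ.dart (τ.dart (τ.dart x (n + 1)).swap 1) (-1) = τ.dart x.swap (-n - 1) := by
      rw [h, sub_eq_add_neg, ← dart_dart, ih, neg_neg]
    rw [← h', dart_dart]
    simp [add_comm]

theorem adj_step {x : V × V} (h : G.Adj x.1 x.2) : G.Adj (τ.step x).1 (τ.step x).2 := by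
  have h' := (τ.adj_apply x h).symm
  rw [τ.snd_apply] at h'
  rw [step_apply]
  exact h'

theorem adj_dart {x : V × V} (h : G.Adj x.1 x.2) (n : ℤ) :
    G.Adj (τ.dart x n).1 (τ.dart x n).2 := by
  have hnat : ∀ (m : ℕ) {y : V × V}, G.Adj y.1 y.2 → G.Adj (τ.dart y m).1 (τ.dart y m).2 := by
    intro m
    induction m with
    | zero => exact fun h => h
    | succ m ih =>
      intro y hy
      rw [Nat.cast_succ, ← dart_dart, dart_one]
      exact τ.adj_step (ih hy)
  obtain ⟨m, rfl | rfl⟩ := n.eq_nat_or_neg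
  · exact hnat m h
  · have := hnat m (y := x.swap) h.symm
    rw [dart_swap] at this
    exact this.symm

/-- The undirected edge underlying a pair of vertices. -/
def edge (x : V × V) : Sym2 V := s(x.1, x.2)

theorem edge_eq_edge_iff {x y : V × V} : edge x = edge y ↔ x = y ∨ x = y.swap := by
  simp [edge, Prod.ext_iff]

@[simp] theorem edge_swap (x : V × V) : edge x.swap = edge x := Sym2.eq_swap

theorem edge_ne_edge_step {x : V × V} (h : G.Adj x.1 x.2) : edge x ≠ edge (τ.step x) := by
  rw [Ne, edge_eq_edge_iff, step_apply]
  rintro (h' | h')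
  · exact h.ne (congrArg Prod.fst h')
  · exact τ.apply_ne x h (Prod.ext (congrArg Prod.fst h').symm (τ.snd_apply x))

theorem exists_walk_edges_eq {x : V × V} (h : G.Adj x.1 x.2) (k : ℕ) {u v : V} (hu : u = x.1)
    (hv : v = (τ.dart x k).2) :
    ∃ p : G.Walk u v, p.edges = (List.range (k + 1)).map fun i : ℕ => edge (τ.dart x i) := by
  induction k generalizing x u v with
  | zero =>
    subst hu hv
    exact ⟨.cons h .nil, by simp [edge]⟩
  | succ k ih =>
    subst hu
    obtain ⟨p, hp⟩ := ih (x := τ.step x) (u := x.2) (v := v) (τ.adj_step h)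
      (by rw [step_apply]) (by rw [hv, ← dart_one, dart_dart]; push_cast; rw [add_comm])
    refine ⟨.cons h p, ?_⟩
    rw [SimpleGraph.Walk.edges_cons, hp, List.range_succ_eq_map (n := k + 1), List.map_cons,
      List.map_map]
    congr 1

theorem exists_path_edges_eq (hac : G.IsAcyclic) {x : V × V} (h : G.Adj x.1 x.2) (k : ℕ) :
    ∃ p : G.Walk x.1 (τ.dart x k).2,
      p.IsPath ∧ p.edges = (List.range (k + 1)).map fun i : ℕ => edge (τ.dart x i) := by
  obtain ⟨p, hp⟩ := τ.exists_walk_edges_eq h k rfl rfl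
  refine ⟨p, (hac.isPath_iff_isChain p).2 ?_, hp⟩
  rw [hp, List.isChain_map, List.isChain_iff_getElem]
  intro i hi
  simp only [List.getElem_range]
  push_cast
  rw [← dart_dart τ x i 1, dart_one]
  exact τ.edge_ne_edge_step (τ.adj_dart h i)

theorem injective_dart (hac : G.IsAcyclic) {x : V × V} (h : G.Adj x.1 x.2) :
    Function.Injective fun n : ℕ => τ.dart x n := by
  have hinj : Function.Injective fun n : ℕ => edge (τ.dart x n) := by
    intro i j hij
    obtain ⟨p, hp, hedges⟩ := τ.exists_path_edges_eq hac h (max i j)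
    have hnd := hp.isTrail.edges_nodup
    rw [hedges] at hnd
    exact List.inj_on_of_nodup_map hnd (by simp) (by simp) hij
  exact fun i j hij => hinj (congrArg edge hij)

/-! ### Cutting lines into segments -/

/-- A stretch `x, …, dart x k` of a line between two consecutive corners of a set `C` of corners.
The corner between an edge and its successor on a line is encoded by the directed edge that
precedes it; when `C` is invariant under the pairing, this does not depend on the direction of
travel. -/
structure IsSegment (C : Set (V × V)) (x : V × V) (k : ℕ) : Prop where
  adj : G.Adj x.1 x.2
  first_mem : τ.dart x (-1) ∈ C
  last_mem : τ.dart x k ∈ C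
  notMem : ∀ i : ℕ, i < k → τ.dart x i ∉ C

open Classical in
/-- The edges of the stretch `x, …, dart x k` of a line. -/
noncomputable def segmentEdges (x : V × V) (k : ℕ) : Finset (Sym2 V) :=
  (Finset.range (k + 1)).image fun i : ℕ => edge (τ.dart x i)

/-- The edge sets of the segments into which the corners in `C` cut the lines. -/
def segments (C : Set (V × V)) : Set (Finset (Sym2 V)) :=
  {T | ∃ x k, τ.IsSegment C x k ∧ τ.segmentEdges x k = T}

theorem mem_segmentEdges {x : V × V} {k : ℕ} {e : Sym2 V} :
    e ∈ τ.segmentEdges x k ↔ ∃ i : ℕ, i ≤ k ∧ edge (τ.dart x i) = e := by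
  simp [segmentEdges]

variable {τ} {C : Set (V × V)}

theorem dart_swap_mem_iff (hC : ∀ x, τ.toFun x ∈ C ↔ x ∈ C) (x : V × V) (n : ℤ) :
    τ.dart x.swap n ∈ C ↔ τ.dart x (-n - 1) ∈ C := by
  rw [dart_swap, ← hC, ← dart_neg_one, dart_dart, sub_eq_add_neg]

theorem dart_swap_dart (x : V × V) (k n : ℤ) :
    τ.dart (τ.dart x k).swap n = (τ.dart x (k - n)).swap := by
  rw [dart_swap, dart_dart, sub_eq_add_neg]

theorem IsSegment.reverse (hC : ∀ x, τ.toFun x ∈ C ↔ x ∈ C) {x : V × V} {k : ℕ}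
    (h : τ.IsSegment C x k) : τ.IsSegment C (τ.dart x k).swap k where
  adj := (τ.adj_dart h.adj k).symm
  first_mem := by
    rw [dart_swap_mem_iff hC]
    simpa using h.last_mem
  last_mem := by
    rw [dart_swap_mem_iff hC, dart_dart, show (k : ℤ) + (-k - 1) = -1 by ring]
    exact h.first_mem
  notMem i hi := by
    rw [dart_swap_mem_iff hC, dart_dart,
      show (k : ℤ) + (-i - 1) = ((k - i - 1 : ℕ) : ℤ) by omega]
    exact h.notMem _ (by omega)

theorem segmentEdges_reverse (x : V × V) (k : ℕ) :
    τ.segmentEdges (τ.dart x k).swap k = τ.segmentEdges x k := by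
  ext e
  simp only [mem_segmentEdges, dart_swap_dart, edge_swap]
  constructor
  · rintro ⟨i, hi, rfl⟩
    exact ⟨k - i, by omega, by rw [Nat.cast_sub hi]⟩
  · rintro ⟨i, hi, rfl⟩
    exact ⟨k - i, by omega, by rw [Nat.cast_sub hi, sub_sub_cancel]⟩

/-- A segment can be traversed in the direction prescribed on one of its edges. -/
theorem IsSegment.exists_directed (hC : ∀ x, τ.toFun x ∈ C ↔ x ∈ C) {x : V × V} {k : ℕ}
    (h : τ.IsSegment C x k) {y : V × V} (hy : edge y ∈ τ.segmentEdges x k) :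
    ∃ x', τ.IsSegment C x' k ∧ τ.segmentEdges x' k = τ.segmentEdges x k ∧
      ∃ i : ℕ, i ≤ k ∧ τ.dart x' i = y := by
  obtain ⟨i, hi, hiy⟩ := τ.mem_segmentEdges.1 hy
  rcases edge_eq_edge_iff.1 hiy with hiy | hiy
  · exact ⟨x, h, rfl, i, hi, hiy⟩
  · refine ⟨_, h.reverse hC, segmentEdges_reverse x k, k - i, by omega, ?_⟩
    rw [dart_swap_dart, Nat.cast_sub hi, sub_sub_cancel, hiy, Prod.swap_swap]

theorem IsSegment.eq_of_dart_eq {x x' : V × V} {k k' i i' : ℕ}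
    (h : τ.IsSegment C x k) (h' : τ.IsSegment C x' k') (hi : i ≤ k) (hi' : i' ≤ k')
    (heq : τ.dart x i = τ.dart x' i') : x = x' ∧ k = k' := by
  have key : ∀ {x x' : V × V} {k k' i i' : ℕ}, τ.IsSegment C x k → τ.IsSegment C x' k' →
      i ≤ k → i' ≤ k' → τ.dart x i = τ.dart x' i' → i ≤ i' := by
    intro x x' k k' i i' h h' hi hi' heq
    by_contra hlt
    have hfirst := h'.first_mem
    have hx' : x' = τ.dart x (i - i') := by
      rw [sub_eq_add_neg, ← dart_dart, heq, dart_dart, add_neg_cancel, dart_zero]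
    rw [hx', dart_dart, show (i : ℤ) - i' + -1 = ((i - i' - 1 : ℕ) : ℤ) by omega] at hfirst
    exact h.notMem _ (by omega) hfirst
  obtain rfl : i = i' := le_antisymm (key h h' hi hi' heq) (key h' h hi' hi heq.symm)
  obtain rfl : x = x' := (τ.step ^ (i : ℤ)).injective heq
  refine ⟨rfl, ?_⟩
  rcases lt_trichotomy k k' with hlt | heq' | hlt
  · exact absurd h.last_mem (h'.notMem _ hlt)
  · exact heq'
  · exact absurd h'.last_mem (h.notMem _ hlt)

theorem eq_of_mem_segments (hC : ∀ x, τ.toFun x ∈ C ↔ x ∈ C) {T T' : Finset (Sym2 V)}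
    (hT : T ∈ τ.segments C) (hT' : T' ∈ τ.segments C) {e : Sym2 V} (he : e ∈ T) (he' : e ∈ T') :
    T = T' := by
  obtain ⟨x, k, h, rfl⟩ := hT
  obtain ⟨x', k', h', rfl⟩ := hT'
  obtain ⟨i, hi, rfl⟩ := τ.mem_segmentEdges.1 he
  obtain ⟨y, hy, hyT, j, hj, hyj⟩ := h'.exists_directed hC he'
  obtain ⟨rfl, rfl⟩ := h.eq_of_dart_eq hy hi hj hyj.symm
  exact hyT

/-- Every edge lies on a segment, which reaches as far forward as the first corner in `C`. -/
theorem exists_isSegment (hC : ∀ x, τ.toFun x ∈ C ↔ x ∈ C)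
    (hrec : ∀ x : V × V, G.Adj x.1 x.2 → ∃ n : ℕ, τ.dart x n ∈ C) {x : V × V}
    (h : G.Adj x.1 x.2) :
    ∃ j k : ℕ, τ.IsSegment C (τ.dart x (-j)) (j + k) ∧ τ.dart x k ∈ C := by
  classical
  have hf := hrec x h
  have hb := hrec x.swap h.symm
  refine ⟨Nat.find hb, Nat.find hf, ⟨τ.adj_dart h _, ?_, ?_, fun i hi => ?_⟩, Nat.find_spec hf⟩
  · have := Nat.find_spec hb
    rwa [dart_swap_mem_iff hC, sub_eq_add_neg, ← dart_dart] at this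
  · rw [dart_dart, Nat.cast_add, neg_add_cancel_left]
    exact Nat.find_spec hf
  · rw [dart_dart]
    rcases lt_or_ge i (Nat.find hb) with hlt | hge
    · have := Nat.find_min hb (m := Nat.find hb - i - 1) (by omega)
      rw [dart_swap_mem_iff hC] at this
      rwa [show -(Nat.find hb : ℤ) + i = -((Nat.find hb - i - 1 : ℕ) : ℤ) - 1 by omega]
    · have := Nat.find_min hf (m := i - Nat.find hb) (by omega)
      rwa [show -(Nat.find hb : ℤ) + i = ((i - Nat.find hb : ℕ) : ℤ) by omega]

theorem exists_mem_segments_of_adj (hC : ∀ x, τ.toFun x ∈ C ↔ x ∈ C)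
    (hrec : ∀ x : V × V, G.Adj x.1 x.2 → ∃ n : ℕ, τ.dart x n ∈ C) {x : V × V}
    (h : G.Adj x.1 x.2) : ∃ T ∈ τ.segments C, edge x ∈ T := by
  obtain ⟨j, k, hseg, -⟩ := exists_isSegment hC hrec h
  exact ⟨_, ⟨_, _, hseg, rfl⟩, τ.mem_segmentEdges.2 ⟨j, by omega, by simp⟩⟩

/-- Each segment is contained in exactly one segment for a smaller set of corners. -/
theorem existsUnique_mem_segments {C' : Set (V × V)} (hsub : C' ⊆ C)
    (hC' : ∀ x, τ.toFun x ∈ C' ↔ x ∈ C')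
    (hrec : ∀ x : V × V, G.Adj x.1 x.2 → ∃ n : ℕ, τ.dart x n ∈ C') {T : Finset (Sym2 V)}
    (hT : T ∈ τ.segments C) : ∃! T', T' ∈ τ.segments C' ∧ T ⊆ T' := by
  obtain ⟨x, k, h, rfl⟩ := hT
  obtain ⟨j, k', hseg, hlast⟩ := exists_isSegment hC' hrec h.adj
  have hk : k ≤ k' := by
    by_contra hlt
    exact h.notMem k' (by omega) (hsub hlast)
  have hx : edge (τ.dart x (0 : ℕ)) ∈ τ.segmentEdges x k :=
    τ.mem_segmentEdges.2 ⟨0, by omega, rfl⟩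
  have hT' : τ.segmentEdges x k ⊆ τ.segmentEdges (τ.dart x (-j)) (j + k') := by
    intro e he
    obtain ⟨i, hi, rfl⟩ := τ.mem_segmentEdges.1 he
    exact τ.mem_segmentEdges.2 ⟨j + i, by omega, by simp⟩
  exact ⟨_, ⟨⟨_, _, hseg, rfl⟩, hT'⟩, fun T'' hT'' =>
    eq_of_mem_segments hC' hT''.1 ⟨_, _, hseg, rfl⟩ (hT''.2 hx) (hT' hx)⟩

theorem segments_subset_finitePaths (hac : G.IsAcyclic) (C : Set (V × V)) :
    τ.segments C ⊆ finitePaths G := by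
  rintro T ⟨x, k, h, rfl⟩
  obtain ⟨p, hp, hedges⟩ := τ.exists_path_edges_eq hac h.adj k
  refine ⟨_, _, p, hp, ?_, fun e => ?_⟩
  · rw [← p.length_edges, hedges]
    simp
  · rw [hedges, mem_segmentEdges]
    simp

/-- An endpoint of a segment is the vertex of a corner in `C`: at any other vertex of the segment
the corner joins two edges of the segment, whereas a path has only one edge at its endpoint. -/
theorem exists_mem_of_mem_endpoints (hC : ∀ x, τ.toFun x ∈ C ↔ x ∈ C) {u : V}
    (hu : u ∈ endpoints G (τ.segments C)) : ∃ w ∈ G.neighborSet u, (w, u) ∈ C := by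
  obtain ⟨T, ⟨x, k, h, rfl⟩, v, p, hp, hlen, hT⟩ := hu
  cases p with
  | nil => simp at hlen
  | @cons _ w _ huw q =>
    refine ⟨w, huw, ?_⟩
    have hmem : edge (w, u) ∈ τ.segmentEdges x k := by
      rw [hT, SimpleGraph.Walk.edges_cons, edge, Sym2.eq_swap]
      exact List.mem_cons_self
    obtain ⟨x', h', hedges, i, hi, hiw⟩ := h.exists_directed hC hmem
    by_contra hnot
    have hik : i < k := by
      refine lt_of_le_of_ne hi fun hik => hnot ?_
      rw [← hiw, hik]
      exact h'.last_mem
    have hnext : edge (τ.step (w, u)) ∈ τ.segmentEdges x k := by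
      rw [← hedges]
      refine τ.mem_segmentEdges.2 ⟨i + 1, hik, ?_⟩
      rw [Nat.cast_succ, ← dart_dart, hiw, dart_one]
    rw [hT, SimpleGraph.Walk.edges_cons, List.mem_cons] at hnext
    rcases hnext with hnext | hnext
    · refine τ.edge_ne_edge_step (x := (w, u)) huw.symm ?_
      rw [hnext]
      exact Sym2.eq_swap
    · rw [step_apply] at hnext
      exact ((SimpleGraph.Walk.cons_isPath_iff _ _).1 hp).2
        (q.fst_mem_support_of_mem_edges hnext)

/-! ### Vanishing sets of corners -/

section Markers

variable {V : Type*} {G : SimpleGraph V} (τ : EdgePairing G)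

/-- The limit inferior of `f` along the forward direction of the line of `x`. -/
noncomputable def forwardLiminf (f : V × V → ℝ) (x : V × V) : ℝ :=
  liminf (fun k : ℕ => f (τ.dart x k)) atTop

/-- The directed edges at which `f` is within `1 / (n + 1)` of its limit inferior along the line,
but not equal to it. -/
def forwardMarkers (f : V × V → ℝ) (n : ℕ) : Set (V × V) :=
  {x | |f x - τ.forwardLiminf f x| < 1 / (n + 1 : ℝ) ∧ f x ≠ τ.forwardLiminf f x}

theorem forwardLiminf_dart (f : V × V → ℝ) (x : V × V) (n : ℕ) :
    τ.forwardLiminf f (τ.dart x n) = τ.forwardLiminf f x := by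
  rw [forwardLiminf, forwardLiminf, ← liminf_nat_add (fun k : ℕ => f (τ.dart x k)) n]
  congr 1
  funext k
  rw [dart_dart, Nat.cast_add, add_comm]

theorem antitone_forwardMarkers (f : V × V → ℝ) : Antitone (τ.forwardMarkers f) := by
  intro m n hmn x hx
  exact ⟨hx.1.trans_le (Nat.one_div_le_one_div hmn), hx.2⟩

theorem eventually_notMem_forwardMarkers (f : V × V → ℝ) (x : V × V) :
    ∀ᶠ n in atTop, x ∉ τ.forwardMarkers f n := by
  by_cases hx : f x = τ.forwardLiminf f x
  · exact .of_forall fun n h => h.2 hx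
  · obtain ⟨N, hN⟩ := exists_nat_one_div_lt (abs_pos.2 (sub_ne_zero.2 hx))
    filter_upwards [eventually_ge_atTop N] with n hn h
    exact lt_asymm hN (τ.antitone_forwardMarkers f hn h).1

/-- The values of `f` along a line come arbitrarily close to their limit inferior infinitely often,
and are equal to it at most once. -/
theorem exists_dart_mem_forwardMarkers (hac : G.IsAcyclic) {f : V × V → ℝ}
    (hinj : Function.Injective f) {a b : ℝ} (hf : ∀ x, f x ∈ Icc a b) (n : ℕ) {x : V × V}
    (h : G.Adj x.1 x.2) : ∃ k : ℕ, τ.dart x k ∈ τ.forwardMarkers f n := by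
  have hε : (0 : ℝ) < 1 / (n + 1 : ℝ) := Nat.one_div_pos_of_nat
  have habove : IsBoundedUnder (· ≤ ·) atTop fun k : ℕ => f (τ.dart x k) :=
    isBoundedUnder_of ⟨b, fun k => (hf _).2⟩
  have hbelow : IsBoundedUnder (· ≥ ·) atTop fun k : ℕ => f (τ.dart x k) :=
    isBoundedUnder_of ⟨a, fun k => (hf _).1⟩
  have h1 : ∃ᶠ k : ℕ in atTop, f (τ.dart x k) < τ.forwardLiminf f x + 1 / (n + 1 : ℝ) :=
    frequently_lt_of_liminf_lt habove.isCoboundedUnder_ge (lt_add_of_pos_right _ hε)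
  have h2 : ∀ᶠ k : ℕ in atTop, τ.forwardLiminf f x - 1 / (n + 1 : ℝ) < f (τ.dart x k) :=
    eventually_lt_of_lt_liminf (sub_lt_self _ hε) hbelow
  have h3 : ∀ᶠ k : ℕ in atTop, f (τ.dart x k) ≠ τ.forwardLiminf f x := by
    have hinj' : Function.Injective fun k : ℕ => f (τ.dart x k) :=
      hinj.comp (τ.injective_dart hac h)
    rw [← Nat.cofinite_eq_atTop]
    exact hinj'.tendsto_cofinite.eventually (eventually_cofinite_ne _)
  obtain ⟨k, hk1, hk2, hk3⟩ := (h1.and_eventually (h2.and h3)).exists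
  refine ⟨k, ?_, ?_⟩
  · rw [forwardLiminf_dart, abs_lt]
    constructor <;> linarith
  · rwa [forwardLiminf_dart]

variable [MeasurableSpace V]

theorem measurable_step (hτ : Measurable τ.toFun) : Measurable τ.step := by
  rw [show ⇑τ.step = fun x => (x.2, (τ.toFun x).1) from funext τ.step_apply]
  fun_prop

theorem measurable_dart (hτ : Measurable τ.toFun) (n : ℕ) : Measurable fun x => τ.dart x n := by
  induction n with
  | zero => exact measurable_id
  | succ n ih =>
    have : (fun x => τ.dart x (n + 1 : ℕ)) = fun x => τ.step (τ.dart x n) := by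
      funext x
      rw [Nat.cast_succ, ← dart_dart, dart_one]
    rw [this]
    exact (τ.measurable_step hτ).comp ih

theorem measurable_dart_neg_one (hτ : Measurable τ.toFun) :
    Measurable fun x => τ.dart x (-1) := by
  simp only [dart_neg_one]
  exact hτ.comp measurable_swap

theorem measurableSet_forwardMarkers (hτ : Measurable τ.toFun) {f : V × V → ℝ}
    (hf : Measurable f) (n : ℕ) : MeasurableSet (τ.forwardMarkers f n) := by
  have hα : Measurable (τ.forwardLiminf f) :=
    Measurable.liminf fun k => hf.comp (τ.measurable_dart hτ k)
  have habs : Measurable fun x => |f x - τ.forwardLiminf f x| := by fun_prop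
  exact (measurableSet_lt habs measurable_const).inter (measurableSet_eq_fun hf hα).compl

/-- There is a decreasing sequence of invariant Borel sets of corners, each meeting every line
infinitely often in both directions, in which no corner stays forever. -/
theorem exists_vanishing_corners [StandardBorelSpace V] (hac : G.IsAcyclic)
    (hτ : Measurable τ.toFun) :
    ∃ C : ℕ → Set (V × V), (∀ n, MeasurableSet (C n)) ∧
      (∀ n x, τ.toFun x ∈ C n ↔ x ∈ C n) ∧ Antitone C ∧
      (∀ n, ∀ x : V × V, G.Adj x.1 x.2 → ∃ k : ℕ, τ.dart x k ∈ C n) ∧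
      ∀ x, ∀ᶠ n in atTop, x ∉ C n := by
  obtain ⟨g, hg⟩ := MeasureTheory.exists_measurableEmbedding_real (V × V)
  let f : V × V → ℝ := fun x => Real.arctan (g x)
  have hf : Measurable f := Real.measurable_arctan.comp hg.measurable
  have hinj : Function.Injective f := Real.arctan_injective.comp hg.injective
  have hbd : ∀ x, f x ∈ Icc (-(Real.pi / 2)) (Real.pi / 2) := fun x =>
    ⟨(Real.neg_pi_div_two_lt_arctan _).le, (Real.arctan_lt_pi_div_two _).le⟩
  have hmeas := τ.measurableSet_forwardMarkers hτ hf
  refine ⟨fun n => τ.forwardMarkers f n ∪ τ.toFun ⁻¹' τ.forwardMarkers f n,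
    fun n => (hmeas n).union (hτ (hmeas n)), fun n x => ?_, ?_, fun n x hx => ?_, fun x => ?_⟩
  · simp only [mem_union, mem_preimage, τ.involutive x]
    exact or_comm
  · exact fun m n hmn => union_subset_union (τ.antitone_forwardMarkers f hmn)
      (preimage_mono (τ.antitone_forwardMarkers f hmn))
  · obtain ⟨k, hk⟩ := τ.exists_dart_mem_forwardMarkers hac hinj hbd n hx
    exact ⟨k, Or.inl hk⟩
  · filter_upwards [τ.eventually_notMem_forwardMarkers f x,
      τ.eventually_notMem_forwardMarkers f (τ.toFun x)] with n h1 h2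
    rintro (h | h)
    exacts [h1 h, h2 h]

end Markers

/-! ### Borel families of segments -/

section Borel

variable {V : Type*} {G : SimpleGraph V}

theorem edge_sortEquiv [LinearOrder V] (e : Sym2 V) : edge (Sym2.sortEquiv e : V × V) = e :=
  Sym2.sortEquiv.symm_apply_apply e

variable [MeasurableSpace V]

/-- Unordered pairs can be ordered in a Borel way. -/
theorem measurable_sortEquiv [LinearOrder V]
    (hlt : MeasurableSet {p : V × V | p.1 < p.2}) :
    @Measurable _ _ (sym2Borel V) _ fun e : Sym2 V => (Sym2.sortEquiv e : V × V) := by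
  intro A hA
  change MeasurableSet ((fun p : V × V => ((Sym2.sortEquiv s(p.1, p.2) : V × V))) ⁻¹' A)
  have hfun : (fun p : V × V => ((Sym2.sortEquiv s(p.1, p.2) : V × V))) =
      fun p => if p.1 ≤ p.2 then p else p.swap := by
    funext p
    rcases le_total p.1 p.2 with h | h
    · simp [Sym2.sortEquiv, h]
    · rcases h.lt_or_eq with h' | h'
      · simp [Sym2.sortEquiv, h, h'.not_ge, Prod.swap]
      · simp [Sym2.sortEquiv, h', Prod.ext_iff]
  rw [hfun]
  refine Measurable.ite ?_ measurable_id measurable_swap hA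
  have hle : {p : V × V | p.1 ≤ p.2} = (Prod.swap ⁻¹' {p : V × V | p.1 < p.2})ᶜ := by
    ext p
    simp
  rw [hle]
  exact (measurable_swap hlt).compl

theorem measurableSet_edge_eq [StandardBorelSpace V] {α : Type*} [MeasurableSpace α]
    {f g : α → V × V} (hf : Measurable f) (hg : Measurable g) :
    MeasurableSet {a | edge (f a) = edge (g a)} := by
  simp only [edge_eq_edge_iff]
  exact (measurableSet_eq_fun hf hg).union (measurableSet_eq_fun hf (measurable_swap.comp hg))

variable (τ : EdgePairing G)

/-- Among the tuples that enumerate the edges of a segment, the first directed edge of the segment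
is one of the finitely many directed edges underlying the tuple, so that no quantifier over an
uncountable set is needed. -/
theorem isBorelFamily_segments [StandardBorelSpace V] [LinearOrder V]
    (hlt : MeasurableSet {p : V × V | p.1 < p.2}) (hG : IsBorel G) (hτ : Measurable τ.toFun)
    {C : Set (V × V)} (hC : MeasurableSet C) : IsBorelFamily (τ.segments C) := by
  refine MeasurableSpace.measurableSet_iInf.2 fun m => ?_
  let : MeasurableSpace (Sym2 V) := sym2Borel V
  suffices h : ∀ _ : DecidableEq (Sym2 V), MeasurableSet
      ((fun t : Fin m → Sym2 V => Finset.image t Finset.univ) ⁻¹' τ.segments C) from h _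
  intro _
  let D : Fin m → Bool → (Fin m → Sym2 V) → V × V := fun j b t =>
    if b then (Sym2.sortEquiv (t j) : V × V) else (Sym2.sortEquiv (t j) : V × V).swap
  have hsort : ∀ j, Measurable fun t : Fin m → Sym2 V => (Sym2.sortEquiv (t j) : V × V) :=
    fun j => (measurable_sortEquiv hlt).comp (measurable_pi_apply j)
  have hD : ∀ j b, Measurable (D j b) := by
    rintro j (_ | _)
    exacts [measurable_swap.comp (hsort j), hsort j]
  have hset : (fun t : Fin m → Sym2 V => Finset.image t Finset.univ) ⁻¹' τ.segments C =
      ⋃ k : ℕ, ⋃ j : Fin m, ⋃ b : Bool, {t | τ.IsSegment C (D j b t) k} ∩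
        {t | (∀ l : Fin m, ∃ i : Fin (k + 1),
            edge (τ.dart (D j b t) (i : ℕ)) = edge (Sym2.sortEquiv (t l) : V × V)) ∧
          ∀ i : Fin (k + 1), ∃ l : Fin m,
            edge (τ.dart (D j b t) (i : ℕ)) = edge (Sym2.sortEquiv (t l) : V × V)} := by
    ext t
    simp only [edge_sortEquiv, mem_iUnion]
    constructor
    · rintro ⟨x, k, hseg, hT⟩
      have hmem : ∀ e, (∃ i : ℕ, i ≤ k ∧ edge (τ.dart x i) = e) ↔ ∃ l, t l = e := by
        intro e
        rw [← mem_segmentEdges, hT]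
        simp
      obtain ⟨j, hj⟩ := (hmem (edge x)).1 ⟨0, by omega, rfl⟩
      have hx : ∃ b, D j b t = x := by
        rw [← edge_sortEquiv (t j), edge_eq_edge_iff] at hj
        rcases hj with hj | hj
        · exact ⟨true, hj⟩
        · exact ⟨false, (congrArg Prod.swap hj).trans (Prod.swap_swap x)⟩
      obtain ⟨b, rfl⟩ := hx
      refine ⟨k, j, b, hseg, fun l => ?_, fun i => ?_⟩
      · obtain ⟨i, hi, hil⟩ := (hmem (t l)).2 ⟨l, rfl⟩
        exact ⟨⟨i, by omega⟩, hil⟩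
      · obtain ⟨l, hl⟩ := (hmem _).1 ⟨i, by omega, rfl⟩
        exact ⟨l, hl.symm⟩
    · rintro ⟨k, j, b, hseg, h1, h2⟩
      refine ⟨_, k, hseg, ?_⟩
      ext e
      simp only [mem_segmentEdges, Finset.mem_image, Finset.mem_univ, true_and]
      constructor
      · rintro ⟨i, hi, rfl⟩
        obtain ⟨l, hl⟩ := h2 ⟨i, by omega⟩
        exact ⟨l, hl.symm⟩
      · rintro ⟨l, rfl⟩
        obtain ⟨i, hi⟩ := h1 l
        exact ⟨i, by omega, hi⟩
  rw [hset]
  refine .iUnion fun k => .iUnion fun j => .iUnion fun b => .inter ?_ ?_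
  · have hseg : {t | τ.IsSegment C (D j b t) k} = D j b ⁻¹' ({x | G.Adj x.1 x.2} ∩
        ((fun x => τ.dart x (-1)) ⁻¹' C ∩ ((fun x => τ.dart x k) ⁻¹' C ∩
          ⋂ i : ℕ, ⋂ _ : i < k, ((fun x => τ.dart x i) ⁻¹' C)ᶜ))) := by
      ext t
      simp only [mem_ofPred_eq, mem_preimage, mem_inter_iff, mem_iInter, mem_compl_iff]
      exact ⟨fun h => ⟨h.adj, h.first_mem, h.last_mem, h.notMem⟩,
        fun h => ⟨h.1, h.2.1, h.2.2.1, h.2.2.2⟩⟩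
    rw [hseg]
    exact hD j b (.inter hG (.inter (τ.measurable_dart_neg_one hτ hC)
      (.inter (τ.measurable_dart hτ k hC)
        (.iInter fun i => .iInter fun _ => (τ.measurable_dart hτ i hC).compl))))
  · simp only [ofPred_and, ofPred_forall, ofPred_exists]
    exact .inter
      (.iInter fun l => .iUnion fun i =>
        measurableSet_edge_eq ((τ.measurable_dart hτ i).comp (hD j b)) (hsort l))
      (.iInter fun i => .iUnion fun l =>
        measurableSet_edge_eq ((τ.measurable_dart hτ i).comp (hD j b)) (hsort l))

end Borel

end EdgePairing

end BorelGraph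

/-! ### The sequence of path families -/

theorem proposition4p2 {V : Type*} [MeasurableSpace V] [StandardBorelSpace V]
    (G : SimpleGraph V) (hBorel : BorelGraph.IsBorel G)
    (hbdd : BorelGraph.IsBoundedDegree G) (hacyclic : G.IsAcyclic)
    (heven : ∀ v : V, Even (G.neighborSet v).ncard) :
    ∃ P : ℕ → Set (Finset (Sym2 V)),
      (∀ n, P n ⊆ BorelGraph.finitePaths G ∧ BorelGraph.IsBorelFamily (P n)) ∧
      (∀ e ∈ G.edgeSet, ∃ T ∈ P 0, e ∈ T) ∧
      (∀ n, ∀ T ∈ P n, ∀ T' ∈ P n, T ≠ T' → Disjoint T T') ∧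
      (∀ n, ∀ T ∈ P n, ∃! T', T' ∈ P (n + 1) ∧ T ⊆ T') ∧
      (⋂ n, BorelGraph.endpoints G (P n)) = ∅ := by
  classical
  obtain ⟨g, hg⟩ := MeasureTheory.exists_measurableEmbedding_real V
  let : LinearOrder V := LinearOrder.lift' g hg.injective
  have hlt : MeasurableSet {p : V × V | p.1 < p.2} :=
    measurableSet_lt (α := ℝ) (hg.measurable.comp measurable_fst)
      (hg.measurable.comp measurable_snd)
  obtain ⟨τ, hτ⟩ := BorelGraph.exists_measurable_edgePairing hlt hBorel hbdd heven
  obtain ⟨C, hCmeas, hC, hanti, hrec, hvanish⟩ := τ.exists_vanishing_corners hacyclic hτ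
  refine ⟨fun n => τ.segments (C n), fun n => ⟨BorelGraph.EdgePairing.segments_subset_finitePaths
    hacyclic _, τ.isBorelFamily_segments hlt hBorel hτ (hCmeas n)⟩, ?_, ?_, ?_, ?_⟩
  · rintro ⟨a, b⟩ he
    exact BorelGraph.EdgePairing.exists_mem_segments_of_adj (x := (a, b)) (hC 0) (hrec 0) he
  · intro n T hT T' hT' hne
    refine Finset.disjoint_left.2 fun e he he' => hne ?_
    exact BorelGraph.EdgePairing.eq_of_mem_segments (hC n) hT hT' he he'
  · intro n T hT
    exact BorelGraph.EdgePairing.existsUnique_mem_segments (hanti n.le_succ) (hC _) (hrec _) hT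
  · refine Set.eq_empty_of_forall_notMem fun u hu => ?_
    obtain ⟨d, hd⟩ := hbdd
    have hfin : (G.neighborSet u).Finite := Set.finite_of_encard_le_coe (hd u)
    -- The finitely many corners at `u` have all left the sets `C n` from some `n` on.
    obtain ⟨n, hn⟩ := ((Filter.eventually_all_finite hfin).2 fun w _ => hvanish (w, u)).exists
    obtain ⟨w, hw, hwC⟩ :=
      BorelGraph.EdgePairing.exists_mem_of_mem_endpoints (hC n) (Set.mem_iInter.1 hu n)
    exact hn w hw hwC
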